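/- Let $f$ be a non-zero polynomial with complex coefficients and, for $n \in \mathbb{N}$, let $M_n(f)=\int_0^1 f(x)^n\,dx$. Then $\limsup_{n\to\infty} |M_n(f)|^{1/n} > 0$. In particular, $M_n(f)\neq 0$ for infinitely many $n\in\mathbb{N}$. -/

import Mathlib

/-- The `n`-th moment `M_n(f) = ∫_0^1 f(x)^n dx` of a complex polynomial `f` on `[0, 1]`. -/
noncomputable def moment (f : Polynomial ℂ) (n : ℕ) : ℂ :=
  ∫ x in (0 : ℝ)..1, (f.eval (x : ℂ)) ^ n

/-! Suppose the moments of a nonconstant `f` decay superexponentially, and let `W` be the space of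
polynomials `h` for which `∫ h f^k` does. Multiplication by `f` shifts `k`, so `h ∈ W` iff `f * h ∈
W`. Since `ℂ[X]` is a Noetherian `ℂ[f]`-module, `W` is generated by a finite set `G`. With `m k` the
sum of the absolute `k`-th moments of `G`, every `h ∈ W` has moments bounded by finitely many shifts
of `m`.

The crux is to gain one more shift. Choose a polynomial `v` vanishing at 0 and 1 with `f' v = f
Q(f)` and `Q(0) = 1`. Integrating `(h v f^k)'` shows that `W` is stable under `h ↦ (h v)'`, which
acts on moments as `-k` modulo terms carrying an extra factor `f`. Subtracting suitable `r h` with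
`r > 0` makes `h` divisible by one more root of `f`, while on moments this only multiplies by `-(k +
r)`, up to shifted terms. After `deg f` rounds `f` divides the result, and the shift is gained
(`dominated_shift_of_dvd`).

Hence `m k ≤ C ∑ m (k + 1 + j)`, which together with superexponential decay forces `m = 0`
(`eq_zero_of_le_sum_shifts`). But `1 ∈ W` has zeroth moment 1. -/

open Polynomial

/-! ### Domination by shifts and superexponential decay -/

/-- `Dominated m s`: the sequence `s` is bounded by a constant times finitely many shifts of `m`. -/
def Dominated (m : ℕ → ℝ) (s : ℕ → ℂ) : Prop :=
  ∃ C : ℝ, 0 ≤ C ∧ ∃ J : ℕ, ∀ k, ‖s k‖ ≤ C * ∑ j ∈ Finset.range J, m (k + j)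

theorem Dominated.add {m : ℕ → ℝ} (hm : ∀ k, 0 ≤ m k) {s t : ℕ → ℂ}
    (hs : Dominated m s) (ht : Dominated m t) : Dominated m (fun k => s k + t k) := by
  obtain ⟨C, hC, J, h⟩ := hs
  obtain ⟨C', hC', J', h'⟩ := ht
  refine ⟨C + C', by positivity, max J J', fun k => (norm_add_le _ _).trans ?_⟩
  rw [add_mul]
  refine add_le_add ((h k).trans ?_) ((h' k).trans ?_)
  · exact mul_le_mul_of_nonneg_left (Finset.sum_le_sum_of_subset_of_nonneg
      (Finset.range_mono (le_max_left _ _)) fun _ _ _ => hm _) hC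
  · exact mul_le_mul_of_nonneg_left (Finset.sum_le_sum_of_subset_of_nonneg
      (Finset.range_mono (le_max_right _ _)) fun _ _ _ => hm _) hC'

theorem Dominated.of_norm_le {m : ℕ → ℝ} {s t : ℕ → ℂ} (hs : Dominated m s) (c : ℝ)
    (hc : 0 ≤ c) (h : ∀ k, ‖t k‖ ≤ c * ‖s k‖) : Dominated m t := by
  obtain ⟨C, hC, J, hJ⟩ := hs
  refine ⟨c * C, by positivity, J, fun k => (h k).trans ?_⟩
  rw [mul_assoc]
  exact mul_le_mul_of_nonneg_left (hJ k) hc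

theorem Dominated.shift {m : ℕ → ℝ} {s : ℕ → ℂ} (hs : Dominated m s) :
    Dominated (fun k => m (k + 1)) (fun k => s (k + 1)) := by
  obtain ⟨C, hC, J, h⟩ := hs
  refine ⟨C, hC, J, fun k => (h (k + 1)).trans_eq ?_⟩
  simp only [add_right_comm]

theorem Dominated.of_shift {m : ℕ → ℝ} (hm : ∀ k, 0 ≤ m k) {s : ℕ → ℂ}
    (hs : Dominated (fun k => m (k + 1)) s) : Dominated m s := by
  obtain ⟨C, hC, J, h⟩ := hs
  refine ⟨C, hC, J + 1, fun k => (h k).trans (mul_le_mul_of_nonneg_left ?_ hC)⟩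
  rw [Finset.sum_range_succ']
  simpa [add_assoc] using hm k

/-- Superexponential decay of a sequence. -/
def SuperDecay (s : ℕ → ℂ) : Prop :=
  ∀ ε : ℝ, 0 < ε → ∃ C : ℝ, ∀ k, ‖s k‖ ≤ C * ε ^ k

theorem SuperDecay.add {s t : ℕ → ℂ} (hs : SuperDecay s) (ht : SuperDecay t) :
    SuperDecay (fun k => s k + t k) := by
  intro ε hε
  obtain ⟨C, h⟩ := hs ε hε
  obtain ⟨D, h'⟩ := ht ε hε
  exact ⟨C + D, fun k => (norm_add_le _ _).trans (by rw [add_mul]; exact add_le_add (h k) (h' k))⟩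

theorem SuperDecay.const_mul {s : ℕ → ℂ} (hs : SuperDecay s) (c : ℂ) :
    SuperDecay (fun k => c * s k) := by
  intro ε hε
  obtain ⟨C, h⟩ := hs ε hε
  refine ⟨‖c‖ * C, fun k => ?_⟩
  rw [norm_mul, mul_assoc]
  exact mul_le_mul_of_nonneg_left (h k) (norm_nonneg _)

theorem SuperDecay.shift {s : ℕ → ℂ} (hs : SuperDecay s) : SuperDecay (fun k => s (k + 1)) := by
  intro ε hε
  obtain ⟨C, h⟩ := hs ε hε
  exact ⟨C * ε, fun k => (h (k + 1)).trans_eq (by ring)⟩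

theorem SuperDecay.of_shift {s : ℕ → ℂ} (hs : SuperDecay (fun k => s (k + 1))) :
    SuperDecay s := by
  intro ε hε
  obtain ⟨C, h⟩ := hs ε hε
  refine ⟨max ‖s 0‖ (C / ε), fun k => ?_⟩
  cases k with
  | zero => simp
  | succ k =>
    calc ‖s (k + 1)‖ ≤ C * ε ^ k := h k
      _ = C / ε * ε ^ (k + 1) := by rw [pow_succ]; field_simp
      _ ≤ _ := mul_le_mul_of_nonneg_right (le_max_right _ _) (by positivity)

theorem SuperDecay.index_mul {s : ℕ → ℂ} (hs : SuperDecay s) :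
    SuperDecay (fun k => (k : ℂ) * s k) := by
  intro ε hε
  obtain ⟨C, h⟩ := hs (ε / 2) (by positivity)
  have hC : 0 ≤ C := by simpa using (norm_nonneg _).trans (h 0)
  refine ⟨C, fun k => ?_⟩
  rw [norm_mul, Complex.norm_natCast]
  have hk : (k : ℝ) ≤ 2 ^ k := by exact_mod_cast (Nat.lt_two_pow_self (n := k)).le
  calc (k : ℝ) * ‖s k‖ ≤ 2 ^ k * (C * (ε / 2) ^ k) :=
        mul_le_mul hk (h k) (norm_nonneg _) (by positivity)
    _ = C * ε ^ k := by rw [div_pow]; field_simp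

theorem SuperDecay.of_eventually {s : ℕ → ℂ}
    (h : ∀ ε : ℝ, 0 < ε → ∀ᶠ n in Filter.atTop, ‖s n‖ ≤ ε ^ n) : SuperDecay s := by
  intro ε hε
  obtain ⟨N, hN⟩ := Filter.eventually_atTop.1 (h ε hε)
  refine ⟨1 + ∑ n ∈ Finset.range N, ‖s n‖ / ε ^ n, fun k => ?_⟩
  have hnn : ∀ n ∈ Finset.range N, 0 ≤ ‖s n‖ / ε ^ n := fun n _ => by positivity
  rw [← div_le_iff₀ (by positivity)]
  rcases lt_or_ge k N with hk | hk
  · have := Finset.single_le_sum hnn (Finset.mem_range.2 hk)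
    linarith
  · have h1 : ‖s k‖ / ε ^ k ≤ 1 := (div_le_one (by positivity)).2 (hN k hk)
    have := Finset.sum_nonneg hnn
    linarith

/-- A bound `m k ≤ A ε^k` fed into the recursion returns with `A` multiplied by `C J ε`. For `ε`
small this factor is at most 1/2, and iterating sends the constant to 0. -/
theorem eq_zero_of_le_sum_shifts {m : ℕ → ℝ} (hm : ∀ k, 0 ≤ m k) {C : ℝ} (hC : 0 ≤ C) {J : ℕ}
    (h : ∀ k, m k ≤ C * ∑ j ∈ Finset.range J, m (k + 1 + j))
    (hd : ∀ ε : ℝ, 0 < ε → ∃ A : ℝ, ∀ k, m k ≤ A * ε ^ k) (k : ℕ) : m k = 0 := by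
  set ε : ℝ := 1 / (2 * (C * J + 1)) with hε
  have hε0 : 0 < ε := by positivity
  have hCJ : C * (J * ε) ≤ 1 / 2 := by
    rw [hε]; field_simp; linarith
  have hε1 : ε ≤ 1 := by
    rw [hε, div_le_one (by positivity)]; nlinarith [mul_nonneg hC (Nat.cast_nonneg (α := ℝ) J)]
  obtain ⟨A, hA⟩ := hd ε hε0
  have hA0 : 0 ≤ A := by simpa using (hm 0).trans (hA 0)
  have key : ∀ n : ℕ, ∀ k, m k ≤ A * (1 / 2) ^ n * ε ^ k := by
    intro n
    induction n with
    | zero => simpa using hA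
    | succ n ih =>
      intro k
      have hb : ∀ j ∈ Finset.range J, m (k + 1 + j) ≤ A * (1 / 2) ^ n * ε ^ (k + 1) := fun j _ =>
        (ih _).trans (mul_le_mul_of_nonneg_left
          (pow_le_pow_of_le_one hε0.le hε1 (by omega)) (by positivity))
      calc m k ≤ C * ∑ j ∈ Finset.range J, m (k + 1 + j) := h k
        _ ≤ C * (J * (A * (1 / 2) ^ n * ε ^ (k + 1))) := by
          refine mul_le_mul_of_nonneg_left ?_ hC
          simpa using Finset.sum_le_card_nsmul _ _ _ hb
        _ = C * (J * ε) * (A * (1 / 2) ^ n * ε ^ k) := by ring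
        _ ≤ 1 / 2 * (A * (1 / 2) ^ n * ε ^ k) :=
          mul_le_mul_of_nonneg_right hCJ (by positivity)
        _ = _ := by ring
  refine le_antisymm (ge_of_tendsto' (f := fun n : ℕ => A * (1 / 2 : ℝ) ^ n * ε ^ k)
    (x := Filter.atTop) ?_ fun n => key n k) (hm k)
  have := ((tendsto_pow_atTop_nhds_zero_of_lt_one (r := (1 / 2 : ℝ)) (by norm_num)
    (by norm_num)).const_mul A).mul_const (ε ^ k)
  simpa using this

/-! ### Finite generation over `ℂ[f]` -/

/-- Division by `f` shows that `1, X, …, X^(deg f - 1)` span `ℂ[X]` over `ℂ[f]`, so this module is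
Noetherian. Quantifying over `V` expresses generation without mentioning the module structure. -/
theorem exists_generators_of_mul_invariant {f : ℂ[X]} (hf : 0 < f.natDegree)
    (W : Submodule ℂ ℂ[X]) (hW : ∀ h ∈ W, f * h ∈ W) :
    ∃ G : Finset ℂ[X], (∀ g ∈ G, g ∈ W) ∧
      ∀ V : Submodule ℂ ℂ[X], (∀ g ∈ G, g ∈ V) → (∀ h ∈ V, f * h ∈ V) → W ≤ V := by
  classical
  let e := Module.AEval.of ℂ ℂ[X] f
  have hfin : Module.Finite ℂ[X] (Module.AEval ℂ ℂ[X] f) := by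
    refine ⟨⟨(Finset.range f.natDegree).image fun i => e (X ^ i), ?_⟩⟩
    set S := Submodule.span ℂ[X]
      (((Finset.range f.natDegree).image fun i => e (X ^ i) : Finset _) :
        Set (Module.AEval ℂ ℂ[X] f)) with hS
    have hlow : ∀ p : ℂ[X], p.natDegree < f.natDegree → e p ∈ S := by
      intro p hp
      rw [p.as_sum_range_C_mul_X_pow, map_sum]
      refine S.sum_mem fun i hi => ?_
      rw [← smul_eq_C_mul, map_smul]
      refine (S.restrictScalars ℂ).smul_mem _ (Submodule.subset_span ?_)
      simp only [Finset.coe_image, Set.mem_image, Finset.coe_range, Set.mem_Iio]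
      exact ⟨i, by have := Finset.mem_range.1 hi; omega, rfl⟩
    have hall : ∀ n : ℕ, ∀ p : ℂ[X], p.natDegree < n → e p ∈ S := by
      intro n
      induction n with
      | zero => intro p hp; omega
      | succ n ih =>
        intro p hp
        rcases lt_or_ge p.natDegree f.natDegree with h | h
        · exact hlow p h
        · rw [← EuclideanDomain.div_add_mod p f, map_add]
          refine S.add_mem ?_ (hlow _ (natDegree_mod_lt p hf.ne'))
          have : e (f * (p / f)) = (X : ℂ[X]) • e (p / f) :=
            (Module.AEval.X_smul_of f (p / f)).symm
          rw [this]
          refine S.smul_mem _ (ih _ ?_)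
          have hp0 : p ≠ 0 := by rintro rfl; rw [natDegree_zero] at h; omega
          rcases eq_or_ne (p / f) 0 with h0 | h0
          · rw [h0, natDegree_zero]; omega
          · have := natDegree_lt_natDegree h0
              (degree_div_lt hp0 (natDegree_pos_iff_degree_pos.1 hf))
            omega
    rw [eq_top_iff]
    rintro x -
    exact hall (((e.symm x).natDegree) + 1) (e.symm x) (Nat.lt_succ_self _)
  have hinv : ∀ V : Submodule ℂ ℂ[X], (∀ h ∈ V, f * h ∈ V) →
      V ∈ (Algebra.lsmul ℂ ℂ ℂ[X] f).invtSubmodule := fun V hV h hh => hV h hh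
  let M := Module.AEval.mapSubmodule ℂ ℂ[X] f
  obtain ⟨G, hG⟩ := (isNoetherian_def.1 (inferInstanceAs
    (IsNoetherian ℂ[X] (Module.AEval ℂ ℂ[X] f)))) (M ⟨W, hinv W hW⟩)
  refine ⟨G.image e.symm, fun g hg => ?_, fun V hV hfV h hh => ?_⟩
  · obtain ⟨x, hx, rfl⟩ := Finset.mem_image.1 hg
    have : x ∈ M ⟨W, hinv W hW⟩ := hG ▸ Submodule.subset_span hx
    simpa [M] using this
  · have hle : M ⟨W, hinv W hW⟩ ≤ M ⟨V, hinv V hfV⟩ := by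
      rw [← hG, Submodule.span_le]
      intro x hx
      have := hV (e.symm x) (Finset.mem_image_of_mem _ hx)
      simpa [M] using this
    have : e h ∈ M ⟨V, hinv V hfV⟩ := hle (by simpa [M, e] using hh)
    simpa [M, e] using this

/-! ### The vector field `v` and its behaviour at the roots of `f` -/

/-- Take `Q = ∏ (1 - X / f(b))` over the roots `b` of `q` with multiplicity: each factor, composed
with `f`, vanishes at its `b`. -/
theorem exists_dvd_comp_of_no_common_root {f : ℂ[X]} (n : ℕ) :
    ∀ q : ℂ[X], q.natDegree = n → q ≠ 0 → (∀ b, q.IsRoot b → f.eval b ≠ 0) →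
      ∃ Q : ℂ[X], Q.eval 0 = 1 ∧ q ∣ Q.comp f := by
  induction n with
  | zero =>
    intro q hq hq0 _
    refine ⟨1, by simp, ?_⟩
    rw [eq_C_of_natDegree_eq_zero hq] at hq0 ⊢
    exact (isUnit_C.2 (isUnit_iff_ne_zero.2 (by simpa using hq0))).dvd
  | succ n ih =>
    intro q hq hq0 hroot
    obtain ⟨b, hb⟩ := IsAlgClosed.exists_root q
      (by rw [degree_eq_natDegree hq0, hq]; exact_mod_cast n.succ_ne_zero)
    obtain ⟨p, rfl⟩ := dvd_iff_isRoot.2 hb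
    have hp0 : p ≠ 0 := right_ne_zero_of_mul hq0
    obtain ⟨Q, hQ0, hQ⟩ := ih p
      (by rw [natDegree_mul (X_sub_C_ne_zero b) hp0, natDegree_X_sub_C] at hq; omega) hp0
      (fun c hc => hroot c (by simp [IsRoot, IsRoot.def.1 hc]))
    have hfb := hroot b hb
    refine ⟨(1 - C (f.eval b)⁻¹ * X) * Q, by simp [hQ0], ?_⟩
    rw [mul_comp]
    refine mul_dvd_mul (dvd_iff_isRoot.2 ?_) hQ
    simp [IsRoot, hfb]

/-- `f'/f` has a simple pole at `b` whose residue is the multiplicity of `b`, while `v f'/f = Q(f)`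
equals 1 there. So `v` has a simple zero with `v'(b)` the inverse multiplicity. -/
theorem eval_eq_zero_and_derivative_eval_of_isRoot {f v Q : ℂ[X]} (hf : f ≠ 0)
    (hQ : Q.eval 0 = 1) (h : derivative f * v = f * Q.comp f) {b : ℂ} (hb : f.IsRoot b) :
    v.eval b = 0 ∧ ∃ r : ℝ, 0 < r ∧ (derivative v).eval b = r := by
  obtain ⟨g, hg, hgb⟩ := exists_eq_pow_rootMultiplicity_mul_and_not_dvd f hf b
  have hm : 0 < f.rootMultiplicity b := (rootMultiplicity_pos hf).2 hb
  obtain ⟨m, hm'⟩ := Nat.exists_eq_succ_of_ne_zero hm.ne'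
  rw [hm'] at hg
  rw [dvd_iff_isRoot, IsRoot] at hgb
  have hd : derivative f = (X - C b) ^ m * (C ((m : ℂ) + 1) * g + (X - C b) * derivative g) := by
    rw [hg]
    simp [derivative_pow]
    ring
  have hc : (C ((m : ℂ) + 1) * g + (X - C b) * derivative g) * v
      = (X - C b) * g * Q.comp f := by
    refine mul_left_cancel₀ (pow_ne_zero m (X_sub_C_ne_zero b)) ?_
    rw [← mul_assoc, ← hd, h]
    nth_rewrite 1 [hg]
    rw [Nat.succ_eq_add_one]
    ring
  have hm1 : (m : ℂ) + 1 ≠ 0 := by exact_mod_cast m.succ_ne_zero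
  have hv : v.eval b = 0 := by
    have := congrArg (eval b) hc
    simpa [hm1, hgb] using this
  refine ⟨hv, ((m : ℝ) + 1)⁻¹, by positivity, ?_⟩
  have := congrArg (fun p => eval b (derivative p)) hc
  simp only [derivative_mul, eval_add, eval_mul, eval_sub, eval_X, eval_C, sub_self, zero_mul,
    hv, mul_zero, add_zero, eval_comp, IsRoot.def.1 hb, hQ, derivative_sub, derivative_X,
    derivative_C, mul_one, one_mul, sub_zero, zero_add] at this
  push_cast
  field_simp
  refine mul_left_cancel₀ hgb ?_
  linear_combination this

/-- Here `c = v g'/g = ∑ v / (X - a)` over the roots `a` of `g`. At a root `b` of `f`, a summand is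
`v'(b) > 0` if `a = b` and 0 otherwise. -/
theorem exists_log_derivative_of_dvd {f v : ℂ[X]} (hf : f ≠ 0)
    (hv : ∀ b, f.IsRoot b → v.eval b = 0 ∧ ∃ r : ℝ, 0 < r ∧ (derivative v).eval b = r) (n : ℕ) :
    ∀ g : ℂ[X], g.natDegree = n → g ∣ f →
      ∃ c : ℂ[X], derivative g * v = g * c ∧ ∀ b, f.IsRoot b → ∃ r : ℝ, 0 ≤ r ∧ c.eval b = r := by
  induction n with
  | zero =>
    intro g hg _
    refine ⟨0, ?_, fun b _ => ⟨0, le_rfl, by simp⟩⟩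
    rw [eq_C_of_natDegree_eq_zero hg]
    simp
  | succ n ih =>
    intro g hg hgf
    have hg0 : g ≠ 0 := ne_zero_of_dvd_ne_zero hf hgf
    obtain ⟨a, ha⟩ := IsAlgClosed.exists_root g
      (by rw [degree_eq_natDegree hg0, hg]; exact_mod_cast n.succ_ne_zero)
    have haf : f.IsRoot a := ha.dvd hgf
    obtain ⟨p, rfl⟩ := dvd_iff_isRoot.2 ha
    obtain ⟨c, hc, hcr⟩ := ih p
      (by rw [natDegree_mul (X_sub_C_ne_zero a) (right_ne_zero_of_mul hg0),
            natDegree_X_sub_C] at hg; omega) ((dvd_mul_left _ _).trans hgf)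
    obtain ⟨u, hu⟩ := dvd_iff_isRoot.2 (show v.IsRoot a from (hv a haf).1)
    refine ⟨c + u, ?_, fun b hb => ?_⟩
    · simp only [derivative_mul, derivative_sub, derivative_X, derivative_C, sub_zero, one_mul]
      linear_combination (X - C a) * hc + p * hu
    · obtain ⟨r, hr, hcb⟩ := hcr b hb
      by_cases hba : b = a
      · subst hba
        obtain ⟨s, hs, hvb⟩ := (hv b hb).2
        refine ⟨r + s, by positivity, ?_⟩
        rw [hu] at hvb
        simp at hvb
        simp [hcb, hvb]
      · refine ⟨r, hr, ?_⟩
        have := (hv b hb).1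
        rw [hu] at this
        simp [sub_ne_zero.2 hba] at this
        simp [hcb, this]

/-- Writing `h = g p` and `g' v = g c`, the cofactor of `g` in `(h v)'` takes the value `(c(a) +
v'(a)) p(a)` at `a`, so `r = c(a) + v'(a)` cancels it. -/
theorem exists_pos_mul_dvd_derivative_sub {f v : ℂ[X]} (hf : f ≠ 0)
    (hv : ∀ b, f.IsRoot b → v.eval b = 0 ∧ ∃ r : ℝ, 0 < r ∧ (derivative v).eval b = r)
    {g h : ℂ[X]} {a : ℂ} (hga : (X - C a) * g ∣ f) (hgh : g ∣ h) :
    ∃ r : ℝ, 0 < r ∧ (X - C a) * g ∣ derivative (h * v) - C (r : ℂ) * h := by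
  obtain ⟨p, rfl⟩ := hgh
  have ha : f.IsRoot a := dvd_iff_isRoot.1 ((dvd_mul_right _ _).trans hga)
  obtain ⟨c, hc, hcr⟩ := exists_log_derivative_of_dvd hf hv _ g rfl ((dvd_mul_left _ _).trans hga)
  obtain ⟨r, hr, hca⟩ := hcr a ha
  obtain ⟨hva, s, hs, hvs⟩ := hv a ha
  refine ⟨r + s, by positivity, ?_⟩
  have : derivative (g * p * v) - C ((r + s : ℝ) : ℂ) * (g * p)
      = (c * p + derivative p * v + p * derivative v - C ((r + s : ℝ) : ℂ) * p) * g := by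
    simp only [derivative_mul]
    linear_combination p * hc
  rw [this]
  refine mul_dvd_mul_right (dvd_iff_isRoot.2 ?_) g
  simp [IsRoot, hca, hva, hvs]
  ring

theorem exists_comp_vector_field {f : ℂ[X]} (hf : 0 < f.natDegree) :
    ∃ Q v : ℂ[X], Q.eval 0 = 1 ∧ derivative f * v = f * Q.comp f ∧
      v.eval 0 = 0 ∧ v.eval 1 = 0 := by
  classical
  have hf0 : f ≠ 0 := by rintro rfl; simp at hf
  have hd0 : derivative f ≠ 0 := fun h => hf.ne' (derivative_eq_zero.1 h)
  obtain ⟨f₁, hf₁⟩ := EuclideanDomain.gcd_dvd_left f (derivative f)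
  obtain ⟨q, hq⟩ := EuclideanDomain.gcd_dvd_right f (derivative f)
  set D := EuclideanDomain.gcd f (derivative f)
  have hq0 : q ≠ 0 := by rintro rfl; rw [mul_zero] at hq; exact hd0 hq
  have hqroot : ∀ b, q.IsRoot b → f.eval b ≠ 0 := by
    intro b hb hfb
    have hm : 0 < f.rootMultiplicity b := (rootMultiplicity_pos hf0).2 hfb
    have hm' := derivative_rootMultiplicity_of_root (p := f) (t := b) hfb
    -- A common root of `q` and `f` would give `f'` the full multiplicity of `f` there, one too
    -- many.
    have h1 : (X - C b) ^ (f.rootMultiplicity b - 1) ∣ D := by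
      refine EuclideanDomain.dvd_gcd ((pow_dvd_pow _ (Nat.sub_le _ _)).trans
        (pow_rootMultiplicity_dvd f b)) ?_
      rw [← hm']
      exact pow_rootMultiplicity_dvd _ b
    have h2 : (X - C b) ^ (f.rootMultiplicity b - 1) * (X - C b) ∣ derivative f := by
      rw [hq]; exact mul_dvd_mul h1 (dvd_iff_isRoot.2 hb)
    rw [← pow_succ, ← le_rootMultiplicity_iff hd0] at h2
    omega
  -- The factors `l 0` and `l 1` force `v` to vanish at the endpoints. They are trivial where `f`
  -- vanishes, since `v` is then zero anyway and `X - C b` would violate the no-common-root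
  -- condition.
  let l : ℂ → ℂ[X] := fun b => if f.eval b = 0 then 1 else X - C b
  have hl0 : ∀ b, l b ≠ 0 := by
    intro b; simp only [l]; split_ifs
    · exact one_ne_zero
    · exact X_sub_C_ne_zero b
  have hlroot : ∀ c b, (l c).IsRoot b → f.eval b ≠ 0 := by
    intro c b hb
    simp only [l] at hb
    split_ifs at hb with h
    · simp [IsRoot] at hb
    · have : b = c := by simpa [IsRoot, sub_eq_zero] using hb
      rwa [this]
  obtain ⟨Q, hQ, w, hw⟩ := exists_dvd_comp_of_no_common_root (f := f) _ (q * l 0 * l 1) rfl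
    (mul_ne_zero (mul_ne_zero hq0 (hl0 0)) (hl0 1)) (by
      intro b hb
      rw [IsRoot, eval_mul, eval_mul, mul_eq_zero, mul_eq_zero] at hb
      rcases hb with (hb | hb) | hb
      · exact hqroot b hb
      · exact hlroot 0 b hb
      · exact hlroot 1 b hb)
  have hfv : derivative f * (f₁ * l 0 * l 1 * w) = f * Q.comp f := by
    rw [hw, hq]; linear_combination -(q * l 0 * l 1 * w) * hf₁
  have hz : ∀ b, b = 0 ∨ b = 1 → (f₁ * l 0 * l 1 * w).eval b = 0 := by
    intro b hb
    by_cases h : f.eval b = 0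
    · exact (eval_eq_zero_and_derivative_eval_of_isRoot hf0 hQ hfv h).1
    · have : (l b).eval b = 0 := by simp [l, h]
      rcases hb with rfl | rfl <;> simp [this]
  exact ⟨Q, _, hQ, hfv, hz 0 (Or.inl rfl), hz 1 (Or.inr rfl)⟩

/-! ### Weighted moments and integration by parts -/

/-- The sequence `k ↦ ∫_0^1 h(x) f(x)^k dx`. -/
noncomputable def weightedMoment (f h : ℂ[X]) (k : ℕ) : ℂ :=
  ∫ x in (0 : ℝ)..1, (h * f ^ k).eval (x : ℂ)

theorem intervalIntegrable_eval (p : ℂ[X]) :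
    IntervalIntegrable (fun x : ℝ => p.eval (x : ℂ)) MeasureTheory.volume 0 1 :=
  (p.continuous.comp Complex.continuous_ofReal).intervalIntegrable _ _

theorem weightedMoment_add (f g h : ℂ[X]) (k : ℕ) :
    weightedMoment f (g + h) k = weightedMoment f g k + weightedMoment f h k := by
  simp only [weightedMoment, add_mul, eval_add]
  exact intervalIntegral.integral_add (intervalIntegrable_eval _) (intervalIntegrable_eval _)

theorem weightedMoment_C_mul (f h : ℂ[X]) (c : ℂ) (k : ℕ) :
    weightedMoment f (C c * h) k = c * weightedMoment f h k := by
  simp only [weightedMoment, mul_assoc, eval_C_mul]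
  exact intervalIntegral.integral_const_mul _ _

theorem weightedMoment_mul_self (f h : ℂ[X]) (k : ℕ) :
    weightedMoment f (f * h) k = weightedMoment f h (k + 1) := by
  simp only [weightedMoment]
  congr! 3
  ring

theorem integral_eval_derivative (p : ℂ[X]) :
    ∫ x in (0 : ℝ)..1, (derivative p).eval (x : ℂ) = p.eval 1 - p.eval 0 := by
  have := intervalIntegral.integral_eq_sub_of_hasDerivAt (a := 0) (b := 1)
    (f := fun x : ℝ => p.eval (x : ℂ)) (fun x _ => (p.hasDerivAt (x : ℂ)).comp_ofReal)
    (intervalIntegrable_eval _)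
  simpa using this

/-- Integrate `(h v f^k)'`: the boundary terms vanish with `v`, and `f' v = f Q(f)` restores the
power `f^k`. -/
theorem weightedMoment_derivative {f v Q : ℂ[X]} (hfv : derivative f * v = f * Q.comp f)
    (h0 : v.eval 0 = 0) (h1 : v.eval 1 = 0) (h : ℂ[X]) (k : ℕ) :
    weightedMoment f (derivative (h * v)) k = -(k * weightedMoment f (Q.comp f * h) k) := by
  have key : derivative (h * v * f ^ k)
      = derivative (h * v) * f ^ k + C (k : ℂ) * (Q.comp f * h * f ^ k) := by
    rw [derivative_mul]
    cases k with
    | zero => simp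
    | succ k =>
      rw [derivative_pow, Nat.add_sub_cancel, pow_succ]
      linear_combination C ((k + 1 : ℕ) : ℂ) * h * f ^ k * hfv
  have hint := integral_eval_derivative (h * v * f ^ k)
  rw [key] at hint
  simp only [eval_add, eval_C_mul] at hint
  rw [intervalIntegral.integral_add (intervalIntegrable_eval _)
    ((intervalIntegrable_eval _).const_mul _), intervalIntegral.integral_const_mul] at hint
  simp only [weightedMoment]
  simp only [eval_mul, h0, h1, mul_zero, zero_mul, sub_zero] at hint ⊢
  linear_combination hint

/-! ### The module of superexponentially decaying weights -/

/-- Polynomials whose weighted moments decay superexponentially. -/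
def decaySubmodule (f : ℂ[X]) : Submodule ℂ ℂ[X] where
  carrier := {h | SuperDecay (weightedMoment f h)}
  zero_mem' := by
    intro ε hε
    exact ⟨0, fun k => by simp [weightedMoment]⟩
  add_mem' {g h} hg hh := by
    have : weightedMoment f (g + h) = _ := funext (weightedMoment_add f g h)
    rw [Set.mem_ofPred_eq, this]
    exact hg.add hh
  smul_mem' c h hh := by
    have : weightedMoment f (C c * h) = _ := funext (weightedMoment_C_mul f h c)
    rw [Set.mem_ofPred_eq, smul_eq_C_mul, this]
    exact hh.const_mul c

theorem mul_mem_decaySubmodule_iff {f h : ℂ[X]} :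
    f * h ∈ decaySubmodule f ↔ h ∈ decaySubmodule f := by
  have : weightedMoment f (f * h) = _ := funext (weightedMoment_mul_self f h)
  change SuperDecay (weightedMoment f (f * h)) ↔ SuperDecay (weightedMoment f h)
  rw [this]
  exact ⟨SuperDecay.of_shift, SuperDecay.shift⟩

theorem comp_mul_mem_of_mul_invariant {f : ℂ[X]} {V : Submodule ℂ ℂ[X]}
    (hV : ∀ h ∈ V, f * h ∈ V) (Q : ℂ[X]) : ∀ h ∈ V, Q.comp f * h ∈ V := by
  induction Q using Polynomial.induction_on' with
  | add p q hp hq =>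
    intro h hh
    rw [add_comp, add_mul]
    exact V.add_mem (hp h hh) (hq h hh)
  | monomial n c =>
    intro h hh
    rw [monomial_comp, mul_assoc, ← smul_eq_C_mul]
    refine V.smul_mem c ?_
    induction n with
    | zero => simpa using hh
    | succ n ih =>
      rw [pow_succ', mul_assoc]
      exact hV _ ih

theorem derivative_mul_mem_decaySubmodule {f v Q : ℂ[X]}
    (hfv : derivative f * v = f * Q.comp f) (h0 : v.eval 0 = 0) (h1 : v.eval 1 = 0) {h : ℂ[X]}
    (hh : h ∈ decaySubmodule f) : derivative (h * v) ∈ decaySubmodule f := by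
  have hQ : SuperDecay (weightedMoment f (Q.comp f * h)) :=
    comp_mul_mem_of_mul_invariant (fun _ => mul_mem_decaySubmodule_iff.2) Q h hh
  have : weightedMoment f (derivative (h * v)) = _ :=
    funext (weightedMoment_derivative hfv h0 h1 h)
  change SuperDecay (weightedMoment f (derivative (h * v)))
  rw [this]
  simpa using hQ.index_mul.const_mul (-1)

theorem exists_dominating_generators {f : ℂ[X]} (hf : 0 < f.natDegree) :
    ∃ G : Finset ℂ[X], (∀ g ∈ G, g ∈ decaySubmodule f) ∧ ∀ h ∈ decaySubmodule f,
      Dominated (fun k => ∑ g ∈ G, ‖weightedMoment f g k‖) (weightedMoment f h) := by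
  obtain ⟨G, hGW, hG⟩ := exists_generators_of_mul_invariant hf (decaySubmodule f)
    (fun _ => mul_mem_decaySubmodule_iff.2)
  refine ⟨G, hGW, ?_⟩
  set m : ℕ → ℝ := fun k => ∑ g ∈ G, ‖weightedMoment f g k‖ with hm
  have hm0 : ∀ k, 0 ≤ m k := fun k => Finset.sum_nonneg fun _ _ => norm_nonneg _
  let V : Submodule ℂ ℂ[X] :=
    { carrier := {h | Dominated m (weightedMoment f h)}
      zero_mem' := ⟨0, le_rfl, 0, fun k => by simp [weightedMoment]⟩
      add_mem' := fun {g h} hg hh => by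
        have : weightedMoment f (g + h) = _ := funext (weightedMoment_add f g h)
        rw [Set.mem_ofPred_eq, this]
        exact hg.add hm0 hh
      smul_mem' := fun c h hh => by
        refine Dominated.of_norm_le hh ‖c‖ (norm_nonneg _) fun k => ?_
        rw [smul_eq_C_mul, weightedMoment_C_mul, norm_mul] }
  refine hG V (fun g hg => ⟨1, zero_le_one, 1, fun k => ?_⟩) fun h hh => ?_
  · simpa [hm] using Finset.single_le_sum (f := fun g => ‖weightedMoment f g k‖)
      (fun _ _ => norm_nonneg _) hg
  · have : weightedMoment f (f * h) = _ := funext (weightedMoment_mul_self f h)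
    change Dominated m (weightedMoment f (f * h))
    rw [this]
    exact Dominated.of_shift hm0 hh.shift

/-! ### Gaining a shift, and the contradiction -/

/-- Induction on the codegree `n` of the divisor `g`: at `n = 0` the weight is a multiple of `f`,
and each step trades `h` for `(h v)' - r h`, divisible by one more root of `f`. -/
theorem dominated_shift_of_dvd {f v Q : ℂ[X]} (hf : f ≠ 0) (hQ : Q.eval 0 = 1)
    (hfv : derivative f * v = f * Q.comp f) (h0 : v.eval 0 = 0) (h1 : v.eval 1 = 0)
    {m : ℕ → ℝ} (hm : ∀ k, 0 ≤ m k)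
    (hdom : ∀ h ∈ decaySubmodule f, Dominated m (weightedMoment f h)) (n : ℕ) :
    ∀ g : ℂ[X], g ∣ f → f.natDegree = g.natDegree + n → ∀ h ∈ decaySubmodule f, g ∣ h →
      Dominated (fun k => m (k + 1)) (weightedMoment f h) := by
  have hv := fun b hb => eval_eq_zero_and_derivative_eval_of_isRoot (b := b) hf hQ hfv hb
  have hself : ∀ h ∈ decaySubmodule f,
      Dominated (fun k => m (k + 1)) (weightedMoment f (f * h)) := by
    intro h hh
    have : weightedMoment f (f * h) = _ := funext (weightedMoment_mul_self f h)
    rw [this]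
    exact (hdom h hh).shift
  induction n with
  | zero =>
    intro g hgf hdeg h hh hgh
    obtain ⟨w, rfl⟩ : f ∣ h := by
      obtain ⟨e, he⟩ := hgf
      have hg0 : g ≠ 0 := by rintro rfl; simp at he; exact hf he
      have he0 : e ≠ 0 := by rintro rfl; simp at he; exact hf he
      have hed : e.natDegree = 0 := by
        rw [he, natDegree_mul hg0 he0] at hdeg; omega
      rw [eq_C_of_natDegree_eq_zero hed] at he he0
      rw [he]
      exact (isUnit_C.2 (isUnit_iff_ne_zero.2 (by simpa using he0))).mul_right_dvd.2 hgh
    -- The quotient by `f` stays in the decay module, so it is itself dominated by `m`.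
    exact hself w (mul_mem_decaySubmodule_iff.1 hh)
  | succ n ih =>
    intro g hgf hdeg h hh hgh
    obtain ⟨e, he⟩ := hgf
    have hg0 : g ≠ 0 := by rintro rfl; simp at he; exact hf he
    have he0 : e ≠ 0 := by rintro rfl; simp at he; exact hf he
    have hed : e.natDegree = n + 1 := by
      rw [he, natDegree_mul hg0 he0] at hdeg; omega
    obtain ⟨a, ha⟩ := IsAlgClosed.exists_root e
      (by rw [degree_eq_natDegree he0, hed]; exact_mod_cast n.succ_ne_zero)
    obtain ⟨e', rfl⟩ := dvd_iff_isRoot.2 ha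
    have hga : (X - C a) * g ∣ f := ⟨e', by rw [he]; ring⟩
    obtain ⟨r, hr, hdvd⟩ := exists_pos_mul_dvd_derivative_sub hf hv hga hgh
    have hmem : derivative (h * v) - C (r : ℂ) * h ∈ decaySubmodule f := by
      rw [← smul_eq_C_mul]
      exact Submodule.sub_mem _ (derivative_mul_mem_decaySubmodule hfv h0 h1 hh)
        (Submodule.smul_mem _ _ hh)
    have hd := ih _ hga (by rw [natDegree_mul (X_sub_C_ne_zero a) hg0, natDegree_X_sub_C]; omega)
      _ hmem hdvd
    obtain ⟨Q₁, hQ₁⟩ : X ∣ Q - 1 := by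
      rw [X_dvd_iff, coeff_zero_eq_eval_zero]; simp [hQ]
    have hQc : Q.comp f * h = h + f * (Q₁.comp f * h) := by
      have : Q = 1 + X * Q₁ := by rw [← hQ₁]; ring
      rw [this]
      simp only [add_comp, mul_comp, one_comp, X_comp]
      ring
    have hd' := hself _ (comp_mul_mem_of_mul_invariant
      (fun _ => mul_mem_decaySubmodule_iff.2) Q₁ h hh)
    have hm' : ∀ k, 0 ≤ m (k + 1) := fun k => hm _
    -- Integration by parts solved for the moment of `h`. Positivity of `r` makes `k + r` invertible
    -- even at `k = 0` and bounds both coefficients uniformly in `k`.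
    have heq : ∀ k : ℕ, weightedMoment f h k
        = -(((k : ℂ) + r)⁻¹ * weightedMoment f (derivative (h * v) - C (r : ℂ) * h) k)
          + -((k : ℂ) * ((k : ℂ) + r)⁻¹ * weightedMoment f (f * (Q₁.comp f * h)) k) := by
      intro k
      have hkr : (k : ℂ) + r ≠ 0 := by
        have : (0 : ℝ) < k + r := by positivity
        exact_mod_cast this.ne'
      have h2 := weightedMoment_derivative hfv h0 h1 h k
      rw [hQc, weightedMoment_add] at h2
      have h3 := weightedMoment_add f (derivative (h * v) - C (r : ℂ) * h) (C (r : ℂ) * h) k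
      rw [sub_add_cancel, weightedMoment_C_mul] at h3
      field_simp
      linear_combination h2 - h3
    have hnorm : ∀ k : ℕ, ‖((k : ℂ) + r)⁻¹‖ = ((k : ℝ) + r)⁻¹ := by
      intro k
      have : (k : ℂ) + r = ((k + r : ℝ) : ℂ) := by push_cast; rfl
      rw [this, norm_inv, Complex.norm_real, Real.norm_of_nonneg (by positivity)]
    rw [funext heq]
    refine Dominated.add hm' (hd.of_norm_le r⁻¹ (by positivity) fun k => ?_)
      (hd'.of_norm_le 1 zero_le_one fun k => ?_)
    · rw [norm_neg, norm_mul, hnorm]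
      gcongr
      linarith [Nat.cast_nonneg (α := ℝ) k]
    · rw [norm_neg, norm_mul, norm_mul, hnorm, Complex.norm_natCast]
      gcongr
      rw [← div_eq_mul_inv, div_le_one (by positivity)]
      linarith

theorem one_notMem_decaySubmodule {f : ℂ[X]} (hf : 0 < f.natDegree) :
    (1 : ℂ[X]) ∉ decaySubmodule f := by
  intro hone
  have hf0 : f ≠ 0 := by rintro rfl; simp at hf
  obtain ⟨Q, v, hQ, hfv, h0, h1⟩ := exists_comp_vector_field hf
  obtain ⟨G, hGW, hG⟩ := exists_dominating_generators hf
  set m : ℕ → ℝ := fun k => ∑ g ∈ G, ‖weightedMoment f g k‖ with hm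
  have hm0 : ∀ k, 0 ≤ m k := fun k => Finset.sum_nonneg fun _ _ => norm_nonneg _
  have hshift : ∀ g ∈ G, Dominated (fun k => m (k + 1)) (weightedMoment f g) := fun g hg =>
    dominated_shift_of_dvd hf0 hQ hfv h0 h1 hm0 hG f.natDegree 1 (one_dvd f) (by simp) g
      (hGW g hg) (one_dvd g)
  have hsum : ∀ S ⊆ G, Dominated (fun k => m (k + 1))
      (fun k => ((∑ g ∈ S, ‖weightedMoment f g k‖ : ℝ) : ℂ)) := by
    classical
    intro S
    induction S using Finset.induction_on with
    | empty => exact fun _ => ⟨0, le_rfl, 0, fun k => by simp⟩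
    | insert a S ha ih =>
      intro hS
      have ha' := (hshift a (hS (Finset.mem_insert_self _ _))).of_norm_le
        (t := fun k => (‖weightedMoment f a k‖ : ℂ)) 1 zero_le_one fun k => by simp
      have := Dominated.add (fun k => hm0 (k + 1)) ha'
        (ih ((Finset.subset_insert _ _).trans hS))
      simpa only [Finset.sum_insert ha, Complex.ofReal_add] using this
  obtain ⟨C, hC, J, hJ⟩ := hsum G subset_rfl
  have hmz : ∀ k, m k = 0 := by
    refine eq_zero_of_le_sum_shifts hm0 hC (J := J) (fun k => ?_) ?_
    · have := hJ k
      rw [Complex.norm_real, Real.norm_of_nonneg (hm0 k)] at this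
      simpa only [add_right_comm] using this
    · intro ε hε
      choose! A hA using fun g (hg : g ∈ G) => hGW g hg ε hε
      refine ⟨∑ g ∈ G, A g, fun k => ?_⟩
      rw [Finset.sum_mul]
      exact Finset.sum_le_sum fun g hg => hA g hg k
  obtain ⟨C', -, J', hJ'⟩ := hG 1 hone
  have := hJ' 0
  -- At `k = 0` the moment of 1 is `∫ 1 = 1`, yet it is bounded by a sum of zeros.
  norm_num [hmz, weightedMoment] at this

/-! ### Conclusion for the moments -/

theorem not_superDecay_moment {f : ℂ[X]} (hf : f ≠ 0) : ¬ SuperDecay (moment f) := by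
  rcases Nat.eq_zero_or_pos f.natDegree with h | h
  · obtain ⟨c, rfl⟩ : ∃ c, f = C c := ⟨_, eq_C_of_natDegree_eq_zero h⟩
    have hc : c ≠ 0 := by simpa using hf
    intro hd
    refine pow_ne_zero 0 hc (norm_eq_zero.1 ?_)
    -- For constant `f = c`, the identity `‖c‖^k = ‖c‖⁻¹ ‖c‖^(k+1)` is already a recursion of the
    -- required form.
    refine eq_zero_of_le_sum_shifts (m := fun k => ‖c ^ k‖) (fun _ => norm_nonneg _)
      (C := ‖c‖⁻¹) (by positivity) (J := 1) (fun k => ?_) (fun ε hε => ?_) 0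
    · simp [pow_succ]
      field_simp
      rfl
    · simpa [moment] using hd ε hε
  · intro hd
    refine one_notMem_decaySubmodule h ?_
    have : weightedMoment f 1 = moment f := by
      funext k; simp [weightedMoment, moment]
    change SuperDecay (weightedMoment f 1)
    rwa [this]

theorem exists_norm_moment_le_pow (f : ℂ[X]) : ∃ B : ℝ, 0 ≤ B ∧ ∀ n, ‖moment f n‖ ≤ B ^ n := by
  obtain ⟨B, hB⟩ := (isCompact_Icc (a := (0 : ℝ)) (b := 1)).exists_bound_of_continuousOn
    (f.continuous.comp Complex.continuous_ofReal).continuousOn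
  refine ⟨max B 0, le_max_right _ _, fun n => ?_⟩
  have := intervalIntegral.norm_integral_le_of_norm_le_const (a := (0 : ℝ)) (b := 1)
    (f := fun x : ℝ => (f.eval (x : ℂ)) ^ n) (C := max B 0 ^ n) (by
      intro x hx
      rw [Set.uIoc_of_le zero_le_one] at hx
      rw [norm_pow]
      exact pow_le_pow_left₀ (norm_nonneg _)
        ((hB x ⟨hx.1.le, hx.2⟩).trans (le_max_left _ _)) n)
  simpa [moment] using this

theorem theorem1 (f : Polynomial ℂ) (hf : f ≠ 0) :
    0 < Filter.limsup (fun n : ℕ => ‖moment f n‖ ^ (1 / (n : ℝ))) Filter.atTop ∧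
      {n : ℕ | moment f n ≠ 0}.Infinite := by
  constructor
  · by_contra! hle
    refine not_superDecay_moment hf (SuperDecay.of_eventually fun ε hε => ?_)
    obtain ⟨B, hB0, hB⟩ := exists_norm_moment_le_pow f
    -- Boundedness is needed because a real `limsup` carries no information for a sequence unbounded
    -- above.
    have hbdd : Filter.IsBoundedUnder (· ≤ ·) Filter.atTop
        (fun n : ℕ => ‖moment f n‖ ^ (1 / (n : ℝ))) := by
      refine Filter.isBoundedUnder_of_eventually_le (a := B) ?_
      filter_upwards [Filter.eventually_gt_atTop 0] with n hn
      calc ‖moment f n‖ ^ (1 / (n : ℝ)) ≤ (B ^ n) ^ (1 / (n : ℝ)) :=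
            Real.rpow_le_rpow (norm_nonneg _) (hB n) (by positivity)
        _ = B := by rw [one_div, Real.pow_rpow_inv_natCast hB0 hn.ne']
    filter_upwards [Filter.eventually_lt_of_limsup_lt (hle.trans_lt hε) hbdd,
      Filter.eventually_gt_atTop 0] with n hn hn0
    calc ‖moment f n‖ = (‖moment f n‖ ^ (1 / (n : ℝ))) ^ n := by
          rw [one_div, Real.rpow_inv_natCast_pow (norm_nonneg _) hn0.ne']
      _ ≤ ε ^ n := pow_le_pow_left₀ (by positivity) hn.le n
  · intro hfin
    refine not_superDecay_moment hf (SuperDecay.of_eventually fun ε hε => ?_)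
    obtain ⟨N, hN⟩ := hfin.bddAbove
    filter_upwards [Filter.eventually_gt_atTop N] with n hn
    have : moment f n = 0 := by
      by_contra h
      exact absurd (hN h) (not_le.2 hn)
    rw [this, norm_zero]
    positivity
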